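/- Let $n \geq 1$ and $d \geq n$ be integers, and let $\mathbf P^N$ be the projective space parametrizing the hypersurfaces $X = V(f) \subset \mathbf P^n$ of degree $d$ over $\mathbf C$ (nonzero homogeneous forms $f$ of degree $d$ in $n+1$ variables, up to scalars). Then there is a nonempty Zariski open subset $U \subset \mathbf P^N$ such that for every hypersurface $X \in U$ and every point $p \in X$, there are at most $n-1$ lines of $\mathbf P^n$ that pass through $p$ and are contained in $X$. -/

import Mathlib

open scoped LinearAlgebra.Projectivization

/-- Complex projective space of dimension `n`, with its closed points. -/
abbrev ProjSpace (n : ℕ) : Type := ℙ ℂ (Fin (n + 1) → ℂ)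

/-- The vector space of homogeneous forms of degree `d` in `n + 1` variables. -/
abbrev FormSpace (n d : ℕ) : Type := MvPolynomial.homogeneousSubmodule (Fin (n + 1)) ℂ d

/-- The projective space parametrizing hypersurfaces of degree `d` in `n`-dimensional projective
space: nonzero forms of degree `d` up to nonzero scalars. -/
abbrev HypersurfaceSpace (n d : ℕ) : Type := ℙ ℂ (FormSpace n d)

/-- The exponents of the monomials of degree `d` in `n + 1` variables. -/
abbrev MonomialIndex (n d : ℕ) : Type := {m : Fin (n + 1) →₀ ℕ // m.degree = d}

/-- The coefficients of a form: the homogeneous coordinates on `HypersurfaceSpace n d`. -/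
noncomputable def formCoeffs {n d : ℕ} (f : FormSpace n d) : MonomialIndex n d → ℂ :=
  fun m => MvPolynomial.coeff m.1 f.1

/-- The zero locus in projective space of a form of degree `d`. -/
def zeroLocus {n d : ℕ} (F : HypersurfaceSpace n d) : Set (ProjSpace n) :=
  {p | MvPolynomial.eval p.rep F.rep.1 = 0}

/-- Zariski closed subsets of the parameter space: common zeros of homogeneous polynomials in the
homogeneous coordinates (the coefficients of the form). -/
def IsZariskiClosed {n d : ℕ} (Z : Set (HypersurfaceSpace n d)) : Prop :=
  ∃ S : Set (MvPolynomial (MonomialIndex n d) ℂ),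
    (∀ P ∈ S, ∃ k : ℕ, P.IsHomogeneous k) ∧
      Z = {F | ∀ P ∈ S, MvPolynomial.eval (formCoeffs F.rep) P = 0}

def IsZariskiOpen {n d : ℕ} (U : Set (HypersurfaceSpace n d)) : Prop :=
  IsZariskiClosed Uᶜ

/-- A line in projective space: the points lying in a two-dimensional linear subspace. -/
def IsProjLine {n : ℕ} (l : Set (ProjSpace n)) : Prop :=
  ∃ W : Submodule ℂ (Fin (n + 1) → ℂ), Module.finrank ℂ W = 2 ∧ l = {p | p.submodule ≤ W}

/-- The set of lines passing through `p` and contained in `X`. -/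
def linesThrough {n : ℕ} (X : Set (ProjSpace n)) (p : ProjSpace n) : Set (Set (ProjSpace n)) :=
  {l | IsProjLine l ∧ p ∈ l ∧ l ⊆ X}

/-- A homogeneous polynomial's vanishing is unaffected by rescaling the point. -/
theorem eval_smul_eq_zero_iff {σ : Type*} {k : ℕ} {P : MvPolynomial σ ℂ} (hP : P.IsHomogeneous k)
    {a : ℂ} (ha : a ≠ 0) (x : σ → ℂ) :
    MvPolynomial.eval (a • x) P = 0 ↔ MvPolynomial.eval x P = 0 := by
  have h : MvPolynomial.eval (a • x) P = a ^ k * MvPolynomial.eval x P := by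
    rw [MvPolynomial.eval_eq, MvPolynomial.eval_eq, Finset.mul_sum]
    refine Finset.sum_congr rfl fun m hm => ?_
    have hk : m.degree = k := by
      rw [Finsupp.degree_eq_weight_one]
      exact hP (MvPolynomial.mem_support_iff.1 hm)
    simp only [Pi.smul_apply, smul_eq_mul, mul_pow, Finset.prod_mul_distrib,
      Finset.prod_pow_eq_pow_sum]
    rw [← hk, Finsupp.degree_apply]
    ring
  rw [h, mul_eq_zero, or_iff_right (pow_ne_zero k ha)]

/-- Membership in the zero locus does not depend on the chosen representatives. -/
theorem mk_mem_zeroLocus_mk {n d : ℕ} (f : FormSpace n d) (hf : f ≠ 0)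
    (x : Fin (n + 1) → ℂ) (hx : x ≠ 0) :
    Projectivization.mk ℂ x hx ∈ zeroLocus (Projectivization.mk ℂ f hf) ↔
      MvPolynomial.eval x f.1 = 0 := by
  obtain ⟨a, ha⟩ := Projectivization.exists_smul_eq_mk_rep ℂ x hx
  obtain ⟨b, hb⟩ := Projectivization.exists_smul_eq_mk_rep ℂ f hf
  have hf' : f.1.IsHomogeneous d := (MvPolynomial.mem_homogeneousSubmodule d f.1).1 f.2
  have key := eval_smul_eq_zero_iff hf' a.ne_zero x
  simp only [zeroLocus, Set.mem_ofPred_eq]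
  rw [← ha, ← hb]
  simp only [Units.smul_def] at key ⊢
  rw [← key, Submodule.coe_smul, MvPolynomial.smul_eval]
  simp

/-- The vanishing of a homogeneous polynomial in the coefficients does not depend on the chosen
representative of a hypersurface. -/
theorem eval_formCoeffs_mk_rep {n d k : ℕ} {P : MvPolynomial (MonomialIndex n d) ℂ}
    (hP : P.IsHomogeneous k) (f : FormSpace n d) (hf : f ≠ 0) :
    MvPolynomial.eval (formCoeffs (Projectivization.mk ℂ f hf).rep) P = 0 ↔
      MvPolynomial.eval (formCoeffs f) P = 0 := by
  obtain ⟨b, hb⟩ := Projectivization.exists_smul_eq_mk_rep ℂ f hf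
  have : formCoeffs (Projectivization.mk ℂ f hf).rep = (b : ℂ) • formCoeffs f := by
    rw [← hb]
    funext m
    simp [formCoeffs, Units.smul_def]
  rw [this]
  exact eval_smul_eq_zero_iff hP b.ne_zero _

/-!
The proof is a dimension count. Let `n = m + 1`. Suppose that a form `f` of degree `d ≥ n` vanishes
on `n` distinct lines through a point `p`. Normalise a coordinate `j` of `p` to `1` and write the
lines as `p + t • v` with `v j = 0`; then `f (p + t • v)`, as a polynomial in `t`, vanishes for each
of the `n` directions `v`, no two of which are proportional. Let `r + 1` be the rank of the set of
directions, choose `r + 1` independent ones among them, and let `s = n - (r + 1)` be the number of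
the others, which are combinations of these. Up to scaling of the directions, the configuration has
`n + (r + 1) m + s r` affine parameters (`ConfigParam`), in one of finitely many charts
(`ConfigChart`, `exists_config_of_directions`).

For a fixed configuration, the following linear conditions on `f` are independent: `f p = 0`; the
coefficients of `t ^ i` with `1 ≤ i ≤ n` vanish along the `r + 1` independent directions; the
coefficients of `t ^ i` with `s + 1 ≤ i ≤ n` vanish along the `s` others. Conditions in different
degrees do not interact. In a degree `i ≥ s + 1` every direction is separated from all the others
by a product of `i` linear forms: one form for the rest of a basis containing it, and one for each
of the `s` directions outside that basis (`exists_dual_separating`). In a degree `i ≤ s` only the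
independent directions occur, and powers of dual linear forms separate them. Multiplied by powers
of the coordinate `j`, these products give forms dual to the conditions
(`exists_lineConditions_mul_eq_one`). There are `1 + (r + 1) n + s (r + 1)` conditions, one more
than there are parameters.

By Cramer's rule, the forms satisfying the conditions of some configuration are therefore
parametrized, up to scaling, by finitely many polynomial maps from affine spaces of smaller
dimension than the space of forms. The components of such a map are algebraically dependent, so a
nonzero polynomial, which may be taken homogeneous, vanishes on all these forms
(`inHypersurfaceCone_of_card_lt`). Its non-vanishing locus is the required open set.
-/

/-! ### Sets contained in a hypersurface cone -/

/-- A set of vectors of `T → ℂ` lies in a *hypersurface cone* if some nonzero homogeneous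
polynomial (possibly a nonzero constant, when the set is empty) vanishes on it. -/
def InHypersurfaceCone {T : Type*} (B : Set (T → ℂ)) : Prop :=
  ∃ P : MvPolynomial T ℂ, P ≠ 0 ∧ (∃ k : ℕ, P.IsHomogeneous k) ∧
    ∀ f ∈ B, MvPolynomial.eval f P = 0

theorem InHypersurfaceCone.mono {T : Type*} {B C : Set (T → ℂ)} (hC : InHypersurfaceCone C)
    (h : B ⊆ C) : InHypersurfaceCone B := by
  obtain ⟨P, h0, hk, hP⟩ := hC
  exact ⟨P, h0, hk, fun f hf => hP f (h hf)⟩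

theorem InHypersurfaceCone.iUnion {T ι : Type*} [Finite ι] {B : ι → Set (T → ℂ)}
    (h : ∀ i, InHypersurfaceCone (B i)) : InHypersurfaceCone (⋃ i, B i) := by
  have := Fintype.ofFinite ι
  choose P h0 hh hP using h
  choose k hk using hh
  refine ⟨∏ i, P i, Finset.prod_ne_zero_iff.2 fun i _ => h0 i,
    ⟨∑ i, k i, MvPolynomial.IsHomogeneous.prod _ _ _ fun i _ => hk i⟩, fun f hf => ?_⟩
  obtain ⟨i, hi⟩ := Set.mem_iUnion.1 hf
  rw [map_prod]
  exact Finset.prod_eq_zero (Finset.mem_univ i) (hP i f hi)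

theorem eval_smul_of_isHomogeneous {T : Type*} {k : ℕ} {P : MvPolynomial T ℂ}
    (hP : P.IsHomogeneous k) (t : ℂ) (f : T → ℂ) :
    MvPolynomial.eval (t • f) P = t ^ k * MvPolynomial.eval f P := by
  rw [MvPolynomial.eval_eq, MvPolynomial.eval_eq, Finset.mul_sum]
  refine Finset.sum_congr rfl fun m hm => ?_
  have hk : m.degree = k := by
    rw [Finsupp.degree_eq_weight_one]
    exact hP (MvPolynomial.mem_support_iff.1 hm)
  simp only [Pi.smul_apply, smul_eq_mul, mul_pow, Finset.prod_mul_distrib,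
    Finset.prod_pow_eq_pow_sum]
  rw [← hk, Finsupp.degree_apply]
  ring

/-- If a nonzero polynomial vanishes on all multiples of the vectors of `B`, then so does each of
its homogeneous components. -/
theorem inHypersurfaceCone_of_eval_smul {T : Type*} {B : Set (T → ℂ)} {P : MvPolynomial T ℂ}
    (h0 : P ≠ 0) (hP : ∀ f ∈ B, ∀ t : ℂ, MvPolynomial.eval (t • f) P = 0) :
    InHypersurfaceCone B := by
  obtain ⟨k, hk⟩ : ∃ k, MvPolynomial.homogeneousComponent k P ≠ 0 := by
    by_contra! h
    apply h0
    rw [← MvPolynomial.sum_homogeneousComponent P]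
    exact Finset.sum_eq_zero fun i _ => h i
  refine ⟨_, hk, ⟨k, MvPolynomial.homogeneousComponent_isHomogeneous k P⟩, fun f hf => ?_⟩
  -- `t ↦ P (t • f)` is a polynomial in `t` whose coefficients are the values of the components.
  let q : Polynomial ℂ := ∑ i ∈ Finset.range (P.totalDegree + 1),
    Polynomial.C (MvPolynomial.eval f (MvPolynomial.homogeneousComponent i P)) * Polynomial.X ^ i
  have hq : q = 0 := by
    refine Polynomial.funext fun t => ?_
    have := hP f hf t
    rw [← MvPolynomial.sum_homogeneousComponent P, map_sum] at this
    simp only [q, Polynomial.eval_zero, Polynomial.eval_finsetSum, Polynomial.eval_mul,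
      Polynomial.eval_C, Polynomial.eval_pow, Polynomial.eval_X]
    refine Eq.trans (Finset.sum_congr rfl fun i _ => ?_) this
    rw [eval_smul_of_isHomogeneous (MvPolynomial.homogeneousComponent_isHomogeneous i P), mul_comm]
  have hc : q.coeff k = 0 := by rw [hq, Polynomial.coeff_zero]
  rw [Polynomial.finsetSum_coeff] at hc
  rw [Finset.sum_congr rfl fun i _ => Polynomial.coeff_C_mul_X_pow _ i k, Finset.sum_ite_eq] at hc
  by_cases hkd : k ∈ Finset.range (P.totalDegree + 1)
  · simpa [hkd] using hc
  · exact absurd (MvPolynomial.homogeneousComponent_eq_zero k P (by simpa using hkd)) hk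

/-- Polynomials in fewer variables than there are polynomials satisfy a nontrivial relation. -/
theorem exists_ne_zero_aeval_eq_zero_of_card_lt {T τ : Type} [Fintype T] [Fintype τ]
    (h : Fintype.card τ < Fintype.card T) (Φ : T → MvPolynomial τ ℂ) :
    ∃ P : MvPolynomial T ℂ, P ≠ 0 ∧ MvPolynomial.aeval Φ P = 0 := by
  have hn : ¬ AlgebraicIndependent ℂ Φ := by
    intro hi
    have := hi.cardinalMk_le_trdeg
    rw [MvPolynomial.trdeg_of_isDomain] at this
    simp at this
    omega
  rw [algebraicIndependent_iff] at hn
  push Not at hn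
  obtain ⟨P, hP, h0⟩ := hn
  exact ⟨P, h0, hP⟩

/-! ### Dimension count for families of linear systems -/

/-- The solutions of a family of linear systems which, by Cramer's rule, determine the unknowns
indexed by `ρ` from those indexed by `κ`, form a set of dimension at most `#σ + #κ`. -/
theorem inHypersurfaceCone_of_det_ne_zero {σ ρ κ T : Type} [Fintype σ] [Fintype ρ] [DecidableEq ρ]
    [Fintype κ] [Fintype T] (e : ρ ⊕ κ ≃ T) (h : Fintype.card σ < Fintype.card ρ)
    (A : Matrix ρ T (MvPolynomial σ ℂ)) :
    InHypersurfaceCone {f : T → ℂ | ∃ c : σ → ℂ,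
      ((A.map (MvPolynomial.eval c)).submatrix id (e ∘ Sum.inl)).det ≠ 0 ∧
        (A.map (MvPolynomial.eval c)).mulVec f = 0} := by
  classical
  let D : Matrix ρ ρ (MvPolynomial σ ℂ) := A.submatrix id (e ∘ Sum.inl)
  let E : Matrix ρ κ (MvPolynomial σ ℂ) := A.submatrix id (e ∘ Sum.inr)
  let Ψ : ρ ⊕ κ → MvPolynomial (σ ⊕ κ) ℂ := Sum.elim
    (fun i => -∑ k, MvPolynomial.rename Sum.inl ((D.adjugate * E) i k) *
      MvPolynomial.X (Sum.inr k))
    (fun k => MvPolynomial.rename Sum.inl D.det * MvPolynomial.X (Sum.inr k))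
  obtain ⟨P, h0, hP⟩ := exists_ne_zero_aeval_eq_zero_of_card_lt (T := T) (τ := σ ⊕ κ)
    (by rw [← Fintype.card_congr e, Fintype.card_sum, Fintype.card_sum]; omega)
    (fun τ => Ψ (e.symm τ))
  refine inHypersurfaceCone_of_eval_smul h0 ?_
  rintro f ⟨c, hdet, hf⟩ t
  set D' := D.map (MvPolynomial.eval c) with hD'
  set E' := E.map (MvPolynomial.eval c) with hE'
  have hdet' : MvPolynomial.eval c D.det = D'.det := by
    rw [RingHom.map_det]; rfl
  have hD0 : D'.det ≠ 0 := hdet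
  have hadj : (D.adjugate * E).map (MvPolynomial.eval c) = D'.adjugate * E' := by
    rw [Matrix.map_mul]
    congr 1
    exact RingHom.map_adjugate (MvPolynomial.eval c) D
  have hsplit : D'.mulVec (fun i => f (e (Sum.inl i))) +
      E'.mulVec (fun k => f (e (Sum.inr k))) = 0 := by
    rw [← hf]
    ext i
    simp only [Matrix.mulVec, dotProduct, Pi.add_apply]
    rw [← e.sum_comp, Fintype.sum_sum_type]
    rfl
  have hcramer : ∀ i, -∑ k, (D'.adjugate * E') i k * f (e (Sum.inr k)) =
      D'.det * f (e (Sum.inl i)) := by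
    intro i
    have h1 := congrArg (fun w => D'.adjugate.mulVec w) hsplit
    simp only [Matrix.mulVec_add, Matrix.mulVec_mulVec, Matrix.adjugate_mul, Matrix.mulVec_zero,
      Matrix.smul_mulVec, Matrix.one_mulVec] at h1
    have h2 := congrFun h1 i
    simp only [Pi.add_apply, Pi.smul_apply, smul_eq_mul, Pi.zero_apply] at h2
    rw [eq_comm, eq_neg_iff_add_eq_zero]
    exact h2
  let x : σ ⊕ κ → ℂ := Sum.elim c (fun k => (t / D'.det) * f (e (Sum.inr k)))
  have hx : ∀ τ, MvPolynomial.eval x (Ψ (e.symm τ)) = t * f τ := by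
    intro τ
    have hr : ∀ q : MvPolynomial σ ℂ,
        MvPolynomial.eval x (MvPolynomial.rename Sum.inl q) = MvPolynomial.eval c q := by
      intro q
      rw [MvPolynomial.eval_rename]
      rfl
    obtain ⟨y, rfl⟩ := e.surjective τ
    rw [e.symm_apply_apply]
    rcases y with i | k
    · simp only [Ψ, Sum.elim_inl, map_neg, map_sum, map_mul, hr, MvPolynomial.eval_X]
      have h3 : ∀ k, MvPolynomial.eval c ((D.adjugate * E) i k) = (D'.adjugate * E') i k :=
        fun k => congrFun (congrFun hadj i) k
      simp only [h3, x, Sum.elim_inr]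
      have h4 := hcramer i
      have : t * f (e (Sum.inl i)) = (t / D'.det) * (D'.det * f (e (Sum.inl i))) := by
        field_simp
      rw [this, ← h4, mul_neg, Finset.mul_sum]
      congr 1
      refine Finset.sum_congr rfl fun k _ => ?_
      ring
    · simp only [Ψ, Sum.elim_inr, map_mul, hr, MvPolynomial.eval_X, hdet', x]
      field_simp
  have := congrArg (MvPolynomial.eval x) hP
  rw [map_zero, MvPolynomial.aeval_def, MvPolynomial.algebraMap_eq,
    ← MvPolynomial.eval_assoc] at this
  rw [← this]
  congr 2
  ext τ
  simp [hx]

/-- A right-invertible matrix has a maximal minor that does not vanish. -/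
theorem exists_equiv_det_ne_zero {ρ T : Type} [Fintype ρ] [DecidableEq ρ] [Fintype T]
    (M : Matrix ρ T ℂ) (G : Matrix T ρ ℂ) (h : M * G = 1) :
    ∃ e : ρ ⊕ Fin (Fintype.card T - Fintype.card ρ) ≃ T,
      (M.submatrix id (e ∘ Sum.inl)).det ≠ 0 := by
  classical
  have hspan : ⊤ ≤ Submodule.span ℂ (Set.range M.col) := by
    intro y _
    rw [← Matrix.range_mulVecLin]
    exact ⟨G.mulVec y, by simp [h]⟩
  obtain ⟨κ, a, ha, hsp, hli⟩ := exists_linearIndependent' ℂ M.col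
  have : Finite κ := Finite.of_injective a ha
  have := Fintype.ofFinite κ
  let b := Module.Basis.mk hli (hsp ▸ hspan)
  have hcard : Fintype.card ρ = Fintype.card κ := by
    rw [← Module.finrank_eq_card_basis b]; simp
  let e₁ : ρ ≃ κ := Fintype.equivOfCardEq hcard
  let g : ρ → T := a ∘ e₁
  have hg : Function.Injective g := ha.comp e₁.injective
  have hc : Fintype.card (Fin (Fintype.card T - Fintype.card ρ)) =
      Fintype.card ((Set.range g)ᶜ : Set T) := by
    rw [Fintype.card_compl_set, Set.card_range_of_injective hg, Fintype.card_fin]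
  let e : ρ ⊕ Fin (Fintype.card T - Fintype.card ρ) ≃ T :=
    (Equiv.sumCongr (Equiv.ofInjective g hg) (Fintype.equivOfCardEq hc)).trans
      (Equiv.Set.sumCompl (Set.range g))
  refine ⟨e, ?_⟩
  have he : (e ∘ Sum.inl : ρ → T) = g := by
    ext i; simp [e]
  rw [he]
  have hli' : LinearIndependent ℂ (M.submatrix id g).col := hli.comp e₁ e₁.injective
  rw [Matrix.linearIndependent_cols_iff_isUnit, Matrix.isUnit_iff_isUnit_det] at hli'
  exact hli'.ne_zero

/-- **Dimension count.** In a family of systems of `#ρ` linear equations, depending polynomially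
on `#σ < #ρ` parameters, the solutions of the systems of full rank do not fill the space. -/
theorem inHypersurfaceCone_of_card_lt {σ ρ T : Type} [Fintype σ] [Fintype ρ] [DecidableEq ρ]
    [Fintype T] (h : Fintype.card σ < Fintype.card ρ) (A : Matrix ρ T (MvPolynomial σ ℂ)) :
    InHypersurfaceCone {f : T → ℂ | ∃ c : σ → ℂ,
      (∃ G : Matrix T ρ ℂ, A.map (MvPolynomial.eval c) * G = 1) ∧
        (A.map (MvPolynomial.eval c)).mulVec f = 0} := by
  classical
  refine (InHypersurfaceCone.iUnion
    fun e : ρ ⊕ Fin (Fintype.card T - Fintype.card ρ) ≃ T =>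
      inHypersurfaceCone_of_det_ne_zero e h A).mono ?_
  rintro f ⟨c, ⟨G, hG⟩, hf⟩
  obtain ⟨e, he⟩ := exists_equiv_det_ne_zero _ G hG
  exact Set.mem_iUnion.2 ⟨e, c, he, hf⟩

/-! ### Restriction of forms to lines -/

/-- The monomial with exponent `τ`, evaluated at the moving point `p + X • v`: a polynomial in the
parameter `X` of the line. The ring of coefficients is arbitrary so that `p` and `v` may
themselves depend on parameters. -/
noncomputable def lineMonomial {A ι : Type*} [CommRing A] (p v : ι → A) (τ : ι →₀ ℕ) :
    Polynomial A :=
  τ.prod fun a k => (Polynomial.C (p a) + Polynomial.X * Polynomial.C (v a)) ^ k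

theorem map_lineMonomial {A A' ι : Type*} [CommRing A] [CommRing A'] (φ : A →+* A')
    (p v : ι → A) (τ : ι →₀ ℕ) :
    (lineMonomial p v τ).map φ = lineMonomial (φ ∘ p) (φ ∘ v) τ := by
  simp only [lineMonomial, Finsupp.prod, Polynomial.map_prod]
  refine Finset.prod_congr rfl fun a _ => ?_
  simp

/-- The restriction of a polynomial to the line `t ↦ p + t • v`. -/
noncomputable def restrictLine {ι : Type*} (p v : ι → ℂ) : MvPolynomial ι ℂ →ₐ[ℂ] Polynomial ℂ :=
  MvPolynomial.aeval fun a => Polynomial.C (p a) + Polynomial.X * Polynomial.C (v a)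

theorem eval_restrictLine {ι : Type*} (p v : ι → ℂ) (t : ℂ) (f : MvPolynomial ι ℂ) :
    (restrictLine p v f).eval t = MvPolynomial.eval (p + t • v) f := by
  induction f using MvPolynomial.induction_on with
  | C a => simp [restrictLine]
  | add f g hf hg => simp [hf, hg]
  | mul_X f a hf => rw [map_mul, Polynomial.eval_mul, hf]; simp [restrictLine, mul_comm t]

theorem restrictLine_eq_sum {ι : Type*} (p v : ι → ℂ) (f : MvPolynomial ι ℂ) :
    restrictLine p v f =
      ∑ τ ∈ f.support, Polynomial.C (MvPolynomial.coeff τ f) * lineMonomial p v τ := by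
  rw [restrictLine, MvPolynomial.aeval_def, MvPolynomial.eval₂_eq]
  rfl

noncomputable instance fintypeMonomialIndex (n d : ℕ) : Fintype (MonomialIndex n d) :=
  (Finsupp.finite_of_degree_eq (σ := Fin (n + 1)) d).fintype

theorem sum_lineMonomial_mul_formCoeffs {n d : ℕ} (p v : Fin (n + 1) → ℂ) (i : ℕ)
    (f : FormSpace n d) :
    ∑ τ : MonomialIndex n d, (lineMonomial p v τ.1).coeff i * formCoeffs f τ =
      (restrictLine p v f.1).coeff i := by
  classical
  have hf : f.1.IsHomogeneous d := (MvPolynomial.mem_homogeneousSubmodule d f.1).1 f.2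
  have hd : ∀ m ∈ f.1.support, m.degree = d := fun m hm => by
    rw [Finsupp.degree_eq_weight_one]
    exact hf (MvPolynomial.mem_support_iff.1 hm)
  rw [restrictLine_eq_sum, Polynomial.finsetSum_coeff]
  simp only [Polynomial.coeff_C_mul]
  have hS : f.1.support ⊆ (Finsupp.finite_of_degree_eq (σ := Fin (n + 1)) d).toFinset := by
    intro m hm
    simpa using hd m hm
  rw [Finset.sum_subset hS fun m _ hm => by rw [MvPolynomial.notMem_support_iff.1 hm, zero_mul],
    Finset.sum_subtype _ (p := fun m : Fin (n + 1) →₀ ℕ => m.degree = d) (by simp)]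
  exact Finset.sum_congr rfl fun τ _ => mul_comm _ _

/-! ### Forms dual to the vanishing conditions -/

/-- The linear form which agrees with `L` on the hyperplane `x_j = 0` and vanishes at the point
`p`, where `p j = 1`. -/
noncomputable def linearFormThrough {n : ℕ} (p : Fin (n + 1) → ℂ) (j : Fin (n + 1))
    (L : Module.Dual ℂ (Fin (n + 1) → ℂ)) : MvPolynomial (Fin (n + 1)) ℂ :=
  (∑ a, MvPolynomial.C (L (Pi.single a 1)) * MvPolynomial.X a) -
    MvPolynomial.C (L p) * MvPolynomial.X j

theorem isHomogeneous_linearFormThrough {n : ℕ} (p : Fin (n + 1) → ℂ) (j : Fin (n + 1))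
    (L : Module.Dual ℂ (Fin (n + 1) → ℂ)) : (linearFormThrough p j L).IsHomogeneous 1 := by
  refine MvPolynomial.IsHomogeneous.sub (MvPolynomial.IsHomogeneous.sum _ _ _ fun a _ => ?_) ?_
  · exact MvPolynomial.isHomogeneous_C_mul_X _ _
  · exact MvPolynomial.isHomogeneous_C_mul_X _ _

theorem restrictLine_linearFormThrough {n : ℕ} {p v : Fin (n + 1) → ℂ} {j : Fin (n + 1)}
    (hp : p j = 1) (hv : v j = 0) (L : Module.Dual ℂ (Fin (n + 1) → ℂ)) :
    restrictLine p v (linearFormThrough p j L) = Polynomial.X * Polynomial.C (L v) := by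
  refine Polynomial.funext fun t => ?_
  have hL : ∀ w : Fin (n + 1) → ℂ, ∑ a, L (Pi.single a 1) * w a = L w := by
    intro w
    conv_rhs => rw [← Finset.univ_sum_single w, map_sum]
    refine Finset.sum_congr rfl fun a _ => ?_
    rw [mul_comm, ← smul_eq_mul, ← map_smul, ← Pi.single_smul, smul_eq_mul, mul_one]
  have hj : (p + t • v) j = 1 := by simp [hp, hv]
  rw [eval_restrictLine]
  simp only [linearFormThrough, map_sub, map_sum, map_mul, MvPolynomial.eval_C,
    MvPolynomial.eval_X, hL, hj, map_add, map_smul, Polynomial.eval_mul, Polynomial.eval_X,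
    Polynomial.eval_C, smul_eq_mul, mul_one, add_sub_cancel_left]

/-- The form `x_j ^ (d - i) * ∏ L_a` of degree `d`, whose `i` linear factors `L_a` vanish at `p`. -/
noncomputable def productForm {n i : ℕ} (d : ℕ) (hi : i ≤ d) (p : Fin (n + 1) → ℂ)
    (j : Fin (n + 1)) (L : Fin i → Module.Dual ℂ (Fin (n + 1) → ℂ)) : FormSpace n d :=
  ⟨MvPolynomial.X j ^ (d - i) * ∏ a, linearFormThrough p j (L a), by
    rw [MvPolynomial.mem_homogeneousSubmodule]
    have h1 : (∏ a, linearFormThrough p j (L a)).IsHomogeneous (∑ _a : Fin i, 1) :=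
      MvPolynomial.IsHomogeneous.prod _ _ _ fun a _ => isHomogeneous_linearFormThrough p j (L a)
    have h2 := (MvPolynomial.isHomogeneous_X_pow (R := ℂ) j (d - i)).mul h1
    have h3 : d - i + ∑ _a : Fin i, 1 = d := by simp; omega
    rwa [h3] at h2⟩

theorem restrictLine_productForm {n d i : ℕ} (hi : i ≤ d) {p v : Fin (n + 1) → ℂ}
    {j : Fin (n + 1)} (hp : p j = 1) (hv : v j = 0)
    (L : Fin i → Module.Dual ℂ (Fin (n + 1) → ℂ)) :
    restrictLine p v (productForm d hi p j L).1 =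
      Polynomial.C (∏ a, L a v) * Polynomial.X ^ i := by
  have hX : restrictLine p v (MvPolynomial.X j) = 1 := by simp [restrictLine, hp, hv]
  simp only [productForm, map_mul, map_pow, map_prod, hX, one_pow, one_mul,
    restrictLine_linearFormThrough hp hv, Finset.prod_mul_distrib, Finset.prod_const,
    Finset.card_univ, Fintype.card_fin]
  rw [mul_comm]

/-- The matrix of the linear conditions "the coefficient of `X ^ i r` in the restriction of the
form to the line through `p` with direction `v r` vanishes". -/
noncomputable def lineConditions {A ρ : Type*} [CommRing A] {n : ℕ} (d : ℕ) (p : Fin (n + 1) → A)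
    (v : ρ → Fin (n + 1) → A) (i : ρ → ℕ) : Matrix ρ (MonomialIndex n d) A :=
  Matrix.of fun r τ => (lineMonomial p (v r) τ.1).coeff (i r)

theorem lineConditions_mulVec_formCoeffs {ρ : Type*} {n d : ℕ} (p : Fin (n + 1) → ℂ)
    (v : ρ → Fin (n + 1) → ℂ) (i : ρ → ℕ) (f : FormSpace n d) (r : ρ) :
    (lineConditions d p v i).mulVec (formCoeffs f) r = (restrictLine p (v r) f.1).coeff (i r) :=
  sum_lineMonomial_mul_formCoeffs p (v r) (i r) f

theorem map_lineConditions {A A' ρ : Type*} [CommRing A] [CommRing A'] (φ : A →+* A') {n : ℕ}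
    (d : ℕ) (p : Fin (n + 1) → A) (v : ρ → Fin (n + 1) → A) (i : ρ → ℕ) :
    (lineConditions d p v i).map φ = lineConditions d (φ ∘ p) (fun r => φ ∘ v r) i := by
  ext r τ
  simp [lineConditions, ← map_lineMonomial]

/-- Conditions in different degrees are independent, and conditions in the same degree `i` are
independent as soon as products of `i` linear forms separate the directions involved. -/
theorem exists_lineConditions_mul_eq_one {ρ : Type*} [Fintype ρ] [DecidableEq ρ] {n d : ℕ}
    {p : Fin (n + 1) → ℂ} {j : Fin (n + 1)} (hp : p j = 1) {v : ρ → Fin (n + 1) → ℂ}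
    (hv : ∀ r, v r j = 0) {i : ρ → ℕ} (hi : ∀ r, i r ≤ d)
    (h : ∀ r, ∃ L : Fin (i r) → Module.Dual ℂ (Fin (n + 1) → ℂ), (∀ a, L a (v r) ≠ 0) ∧
      ∀ r', r' ≠ r → i r' = i r → ∃ a, L a (v r') = 0) :
    ∃ G : Matrix (MonomialIndex n d) ρ ℂ, lineConditions d p v i * G = 1 := by
  choose L hL hL' using h
  refine ⟨Matrix.of fun τ r =>
    (∏ a, L r a (v r))⁻¹ * formCoeffs (productForm d (hi r) p j (L r)) τ, ?_⟩
  ext r' r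
  have h1 : (lineConditions d p v i * Matrix.of fun τ r =>
      (∏ a, L r a (v r))⁻¹ * formCoeffs (productForm d (hi r) p j (L r)) τ) r' r =
      (∏ a, L r a (v r))⁻¹ *
        (lineConditions d p v i).mulVec (formCoeffs (productForm d (hi r) p j (L r))) r' := by
    simp only [Matrix.mul_apply, Matrix.of_apply, Matrix.mulVec, dotProduct, Finset.mul_sum]
    exact Finset.sum_congr rfl fun τ _ => by ring
  rw [h1, lineConditions_mulVec_formCoeffs, restrictLine_productForm (hi r) hp (hv r'),
    Polynomial.coeff_C_mul_X_pow, Matrix.one_apply]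
  by_cases hr : r' = r
  · subst hr
    rw [if_pos rfl, if_pos rfl, inv_mul_cancel₀ (Finset.prod_ne_zero_iff.2 fun a _ => hL r' a)]
  · rw [if_neg hr]
    split_ifs with hir
    · obtain ⟨a, ha⟩ := hL' r r' hr hir
      rw [Finset.prod_eq_zero (f := fun a => L r a (v r')) (Finset.mem_univ a) ha, mul_zero]
    · rw [mul_zero]

/-! ### Separating points by products of linear forms -/

/-- A point of a finite set of points of rank `r` is separated from the others by a product of
`N ≥ #ι - r + 1` linear forms: one form takes care of the other members of a basis containing the
given point, and every remaining point gets a form of its own. -/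
theorem exists_dual_separating {K V ι : Type*} [Field K] [AddCommGroup V] [Module K V]
    [FiniteDimensional K V] [Fintype ι]
    {v : ι → V} {k : ι} (h0 : v k ≠ 0) (hne : ∀ k', k' ≠ k → v k ∉ Submodule.span K {v k'})
    {N : ℕ} (hN : Fintype.card ι + 1 ≤ N + Module.finrank K (Submodule.span K (Set.range v))) :
    ∃ L : Fin N → Module.Dual K V,
      (∀ a, L a (v k) ≠ 0) ∧ ∀ k', k' ≠ k → ∃ a, L a (v k') = 0 := by
  classical
  have hs : LinearIndepOn K v {k} := LinearIndepOn.singleton h0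
  set b := hs.extend (Set.subset_univ _) with hb
  have hli : LinearIndepOn K v b := hs.linearIndepOn_extend _
  have hkb : k ∈ b := hs.subset_extend (Set.subset_univ _) rfl
  have hrank : Module.finrank K (Submodule.span K (Set.range v)) = Fintype.card b := by
    rw [← Set.image_univ, ← hs.span_image_extend_eq_span_image (Set.subset_univ _),
      Set.image_eq_range]
    exact finrank_span_eq_card hli
  have hcard : Fintype.card (Option (bᶜ : Set ι)) ≤ Fintype.card (Fin N) := by
    have := Fintype.card_compl_set b
    have := set_fintype_card_le_univ b
    rw [Fintype.card_option, Fintype.card_fin]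
    omega
  obtain ⟨g, hg⟩ : ∃ g : Fin N → Option (bᶜ : Set ι), Function.Surjective g := by
    obtain ⟨u⟩ := Function.Embedding.nonempty_of_card_le hcard
    exact ⟨_, Function.invFun_surjective u.injective⟩
  have hsep : ∀ o : Option (bᶜ : Set ι), ∃ f : Module.Dual K V, f (v k) ≠ 0 ∧
      Submodule.span K (o.elim (v '' (b \ {k})) fun k' => {v k'}) ≤ LinearMap.ker f := by
    intro o
    refine Submodule.exists_le_ker_of_notMem ?_
    cases o with
    | none => exact hli.notMem_span hkb
    | some k' => exact hne k' fun h => k'.2 (h ▸ hkb)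
  choose f hf hf' using hsep
  refine ⟨fun a => f (g a), fun a => hf _, fun k' hk' => ?_⟩
  by_cases hk'b : k' ∈ b
  · obtain ⟨a, ha⟩ := hg none
    refine ⟨a, ?_⟩
    simp only [ha]
    exact hf' none (Submodule.subset_span ⟨k', ⟨hk'b, hk'⟩, rfl⟩)
  · obtain ⟨a, ha⟩ := hg (some ⟨k', hk'b⟩)
    refine ⟨a, ?_⟩
    simp only [ha]
    exact hf' (some ⟨k', hk'b⟩) (Submodule.subset_span rfl)

/-! ### Parametrized configurations of directions at a point -/

/-- The parameters of a point and of `r + 1 + s` directions at it: affine coordinates of the point,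
affine coordinates of `r + 1` independent directions, and, for each of `s` further directions in
their span, coordinates with respect to them. In each case one coordinate is normalised to `1` and
left out. -/
abbrev ConfigParam (m r s : ℕ) : Type := Fin (m + 1) ⊕ (Fin (r + 1) × Fin m) ⊕ (Fin s × Fin r)

/-- The charts in which a configuration is parametrized: `j` is the coordinate normalised to `1`
at the point and to `0` in all directions, `l k` the coordinate normalised to `1` in the `k`-th
basis direction, and `μ q` the basis direction which the `q`-th further direction involves with
coefficient `1`. -/
structure ConfigChart (m r s : ℕ) where
  j : Fin (m + 2)
  l : Fin (r + 1) → Fin (m + 1)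
  μ : Fin s → Fin (r + 1)

instance (m r s : ℕ) : Finite (ConfigChart m r s) :=
  Finite.of_injective (β := Fin (m + 2) × (Fin (r + 1) → Fin (m + 1)) × (Fin s → Fin (r + 1)))
    (fun χ => (χ.j, χ.l, χ.μ)) (by
      rintro ⟨⟩ ⟨⟩ h
      simpa using h)

namespace ConfigChart

variable {m r s : ℕ} (χ : ConfigChart m r s) {A : Type*} [CommRing A]

/-- The point of a configuration. -/
def point (x : ConfigParam m r s → A) : Fin (m + 2) → A :=
  χ.j.insertNth (1 : A) fun a => x (Sum.inl a)

/-- The independent directions of a configuration. -/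
def basisDir (x : ConfigParam m r s → A) (k : Fin (r + 1)) : Fin (m + 2) → A :=
  χ.j.insertNth (0 : A) ((χ.l k).insertNth (1 : A) fun a => x (Sum.inr (Sum.inl (k, a))))

/-- All directions of a configuration: the independent ones, and the combinations of them. -/
def dir (x : ConfigParam m r s → A) : Fin (r + 1) ⊕ Fin s → Fin (m + 2) → A :=
  Sum.elim (χ.basisDir x) fun q =>
    ∑ k, (χ.μ q).insertNth (α := fun _ => A) 1 (fun a => x (Sum.inr (Sum.inr (q, a)))) k •
      χ.basisDir x k

theorem comp_insertNth {A A' : Type*} {n : ℕ} (φ : A → A') (i : Fin (n + 1)) (a : A)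
    (y : Fin n → A) :
    φ ∘ (i.insertNth (α := fun _ => A) a y) = i.insertNth (α := fun _ => A') (φ a) (φ ∘ y) := by
  funext b
  refine Fin.succAboveCases i ?_ (fun b => ?_) b <;> simp

theorem comp_point {A' : Type*} [CommRing A'] (φ : A →+* A') (x : ConfigParam m r s → A) :
    φ ∘ χ.point x = χ.point (φ ∘ x) := by
  simp only [point, comp_insertNth, map_one]
  rfl

theorem comp_basisDir {A' : Type*} [CommRing A'] (φ : A →+* A') (x : ConfigParam m r s → A)
    (k : Fin (r + 1)) : φ ∘ χ.basisDir x k = χ.basisDir (φ ∘ x) k := by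
  simp only [basisDir, comp_insertNth, map_one, map_zero]
  rfl

theorem comp_dir {A' : Type*} [CommRing A'] (φ : A →+* A') (x : ConfigParam m r s → A)
    (i : Fin (r + 1) ⊕ Fin s) : φ ∘ χ.dir x i = χ.dir (φ ∘ x) i := by
  rcases i with k | q
  · exact χ.comp_basisDir φ x k
  · funext b
    simp only [dir, Sum.elim_inr, Function.comp_apply, Finset.sum_apply, Pi.smul_apply,
      smul_eq_mul, map_sum, map_mul]
    refine Finset.sum_congr rfl fun k _ => ?_
    congr 1
    · have := congrFun (comp_insertNth φ (χ.μ q) 1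
        (fun a => x (Sum.inr (Sum.inr (q, a))))) k
      simp only [Function.comp_apply, map_one] at this
      exact this
    · exact congrFun (χ.comp_basisDir φ x k) b

theorem point_j (x : ConfigParam m r s → A) : χ.point x χ.j = 1 := by
  simp [point]

theorem dir_j (x : ConfigParam m r s → A) (i : Fin (r + 1) ⊕ Fin s) : χ.dir x i χ.j = 0 := by
  rcases i with k | q <;> simp [dir, basisDir]

end ConfigChart

/-- The conditions imposed on a form by a configuration: vanishing at the point; vanishing of the
coefficients of degrees `1, …, m + 1` along the basis directions; and vanishing of the
coefficients of degrees `s + 1, …, s + r + 1` along the `s` further directions. -/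
abbrev ConfigCondition (m r s : ℕ) : Type :=
  Unit ⊕ (Fin (r + 1) × Fin (m + 1)) ⊕ (Fin s × Fin (r + 1))

/-- The degree in which a condition is imposed. -/
def conditionDegree {m r s : ℕ} : ConfigCondition m r s → ℕ
  | Sum.inl _ => 0
  | Sum.inr (Sum.inl (_, a)) => a + 1
  | Sum.inr (Sum.inr (_, b)) => s + 1 + b

/-- The direction along which a condition is imposed; the condition at the point itself has
degree `0`, so that any direction will do. -/
def conditionDir {m r s : ℕ} {A : Type*} [CommRing A] (χ : ConfigChart m r s)
    (x : ConfigParam m r s → A) : ConfigCondition m r s → Fin (m + 2) → A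
  | Sum.inl _ => 0
  | Sum.inr (Sum.inl (k, _)) => χ.dir x (Sum.inl k)
  | Sum.inr (Sum.inr (q, _)) => χ.dir x (Sum.inr q)

/-- The directions of a configuration are suitably general: the basis directions are independent
and no two directions are proportional. -/
def ConfigChart.IsGeneral {m r s : ℕ} (χ : ConfigChart m r s) (x : ConfigParam m r s → ℂ) : Prop :=
  LinearIndependent ℂ (χ.basisDir x) ∧
    ∀ i i', i' ≠ i → χ.dir x i ∉ Submodule.span ℂ {χ.dir x i'}

theorem ConfigChart.IsGeneral.exists_separating {m r s : ℕ} {χ : ConfigChart m r s}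
    {x : ConfigParam m r s → ℂ} (hx : χ.IsGeneral x) (i : Fin (r + 1) ⊕ Fin s) {N : ℕ}
    (hN : s + 1 ≤ N) :
    ∃ L : Fin N → Module.Dual ℂ (Fin (m + 2) → ℂ), (∀ a, L a (χ.dir x i) ≠ 0) ∧
      ∀ i', i' ≠ i → ∃ a, L a (χ.dir x i') = 0 := by
  refine exists_dual_separating ?_ (hx.2 i) ?_
  · rcases i with k | q
    · exact hx.1.ne_zero k
    · intro h0
      refine hx.2 (Sum.inr q) (Sum.inl 0) (by simp) ?_
      rw [h0]
      exact zero_mem _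
  · have h1 : Module.finrank ℂ (Submodule.span ℂ (Set.range (χ.basisDir x))) = r + 1 := by
      rw [finrank_span_eq_card hx.1, Fintype.card_fin]
    have h2 : Submodule.span ℂ (Set.range (χ.basisDir x)) ≤
        Submodule.span ℂ (Set.range (χ.dir x)) := by
      refine Submodule.span_mono ?_
      rintro _ ⟨k, rfl⟩
      exact ⟨Sum.inl k, rfl⟩
    have h3 := Submodule.finrank_mono h2
    simp only [Fintype.card_sum, Fintype.card_fin]
    omega

/-- In degrees at least `s + 1` all directions are separated; in lower degrees only the basis
directions occur, and these are separated by powers of the forms of a dual basis. -/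
theorem ConfigChart.IsGeneral.exists_lineConditions_mul_eq_one {m r s d : ℕ}
    (hrs : r + 1 + s = m + 1) (hd : m + 1 ≤ d)
    {χ : ConfigChart m r s} {x : ConfigParam m r s → ℂ} (hx : χ.IsGeneral x) :
    ∃ G : Matrix (MonomialIndex (m + 1) d) (ConfigCondition m r s) ℂ,
      lineConditions d (χ.point x) (conditionDir χ x) conditionDegree * G = 1 := by
  refine _root_.exists_lineConditions_mul_eq_one (χ.point_j x) ?_ ?_ ?_
  · rintro (_ | ⟨k, a⟩ | ⟨q, b⟩)
    · rfl
    · exact χ.dir_j x _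
    · exact χ.dir_j x _
  · rintro (_ | ⟨k, a⟩ | ⟨q, b⟩) <;> simp only [conditionDegree] <;> omega
  · rintro (_ | ⟨k, a⟩ | ⟨q, b⟩)
    · refine ⟨fun a => a.elim0, fun a => a.elim0, ?_⟩
      rintro (_ | ⟨k', a'⟩ | ⟨q', b'⟩) hne hdeg
      · exact absurd rfl hne
      · simp [conditionDegree] at hdeg
      · simp [conditionDegree] at hdeg
    · by_cases ha : s + 1 ≤ (a : ℕ) + 1
      · obtain ⟨L, hL, hL'⟩ := hx.exists_separating (Sum.inl k) ha
        refine ⟨L, hL, ?_⟩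
        rintro (_ | ⟨k', a'⟩ | ⟨q', b'⟩) hne hdeg
        · simp [conditionDegree] at hdeg
        · refine hL' (Sum.inl k') fun h => hne ?_
          simp only [conditionDegree] at hdeg
          rw [Sum.inl.inj h, Fin.ext (show (a' : ℕ) = a by omega)]
        · exact hL' (Sum.inr q') (by simp)
      · obtain ⟨f, hf, hf'⟩ := Submodule.exists_le_ker_of_notMem
          (hx.1.notMem_span_image (s := {k}ᶜ) (x := k) (by simp))
        refine ⟨fun _ => f, fun _ => hf, ?_⟩
        rintro (_ | ⟨k', a'⟩ | ⟨q', b'⟩) hne hdeg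
        · simp [conditionDegree] at hdeg
        · refine ⟨⟨0, Nat.succ_pos _⟩, hf' (Submodule.subset_span ⟨k', fun h => hne ?_, rfl⟩)⟩
          simp only [conditionDegree] at hdeg
          rw [Set.mem_singleton_iff.1 h, Fin.ext (show (a' : ℕ) = a by omega)]
        · simp only [conditionDegree] at hdeg
          omega
    · obtain ⟨L, hL, hL'⟩ := hx.exists_separating (Sum.inr q) (Nat.le_add_right (s + 1) b)
      refine ⟨L, hL, ?_⟩
      rintro (_ | ⟨k', a'⟩ | ⟨q', b'⟩) hne hdeg
      · simp [conditionDegree] at hdeg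
        omega
      · exact hL' (Sum.inl k') (by simp)
      · refine hL' (Sum.inr q') fun h => hne ?_
        simp only [conditionDegree] at hdeg
        rw [Sum.inr.inj h, Fin.ext (show (b' : ℕ) = b by omega)]

/-- The coefficient vectors of the forms of degree `d` which vanish, to the extent measured by
`ConfigCondition`, on the lines of some general configuration in the chart `χ`. -/
def badCoeffs {m r s : ℕ} (d : ℕ) (χ : ConfigChart m r s) :
    Set (MonomialIndex (m + 1) d → ℂ) :=
  {f | ∃ x : ConfigParam m r s → ℂ, χ.IsGeneral x ∧
    (lineConditions d (χ.point x) (conditionDir χ x) conditionDegree).mulVec f = 0}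

/-- There is exactly one condition more than there are parameters. -/
theorem inHypersurfaceCone_badCoeffs {m r s d : ℕ} (hrs : r + 1 + s = m + 1) (hd : m + 1 ≤ d)
    (χ : ConfigChart m r s) : InHypersurfaceCone (badCoeffs d χ) := by
  have hcard : Fintype.card (ConfigParam m r s) < Fintype.card (ConfigCondition m r s) := by
    simp only [Fintype.card_sum, Fintype.card_prod, Fintype.card_fin, Fintype.card_unit]
    have : m = r + s := by omega
    subst this
    nlinarith
  refine (inHypersurfaceCone_of_card_lt hcard (lineConditions d (χ.point MvPolynomial.X)
    (conditionDir χ MvPolynomial.X) conditionDegree)).mono ?_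
  rintro f ⟨x, hx, hf⟩
  have hX : (MvPolynomial.eval x : MvPolynomial (ConfigParam m r s) ℂ →+* ℂ) ∘
      (MvPolynomial.X : ConfigParam m r s → MvPolynomial (ConfigParam m r s) ℂ) = x := by
    funext i; simp
  have hdir : (fun c => (MvPolynomial.eval x : MvPolynomial (ConfigParam m r s) ℂ →+* ℂ) ∘
      conditionDir χ MvPolynomial.X c) = conditionDir χ x := by
    funext c
    rcases c with _ | ⟨k, a⟩ | ⟨q, b⟩
    · funext i
      exact map_zero _
    · simp only [conditionDir, ConfigChart.comp_dir, hX]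
    · simp only [conditionDir, ConfigChart.comp_dir, hX]
  refine ⟨x, ?_⟩
  rw [map_lineConditions, χ.comp_point, hX, hdir]
  exact ⟨hx.exists_lineConditions_mul_eq_one hrs hd, hf⟩

/-! ### Putting lines through a point into a chart -/

/-- Pairwise non-proportional directions in the hyperplane `x_j = 0` can be renumbered and rescaled
so as to become the directions of a general configuration in one of the charts. -/
theorem exists_config_of_directions {m : ℕ} {j : Fin (m + 2)}
    {w : Fin (m + 1) → Fin (m + 2) → ℂ} (hwj : ∀ k, w k j = 0) (hw0 : ∀ k, w k ≠ 0)
    (hw : ∀ k k', k' ≠ k → w k ∉ Submodule.span ℂ {w k'})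
    {p : Fin (m + 2) → ℂ} (hp : p j = 1) :
    ∃ r s, r + 1 + s = m + 1 ∧ ∃ (χ : ConfigChart m r s) (x : ConfigParam m r s → ℂ),
      χ.IsGeneral x ∧ χ.point x = p ∧ ∀ i, ∃ (k : Fin (m + 1)) (c : ℂ), χ.dir x i = c • w k := by
  classical
  obtain ⟨κ, a, ha, hsp, hli⟩ := exists_linearIndependent' ℂ w
  have : Finite κ := Finite.of_injective a ha
  have := Fintype.ofFinite κ
  have hκ : Nonempty κ := by
    by_contra hempty
    rw [not_nonempty_iff] at hempty
    rw [Set.range_eq_empty, Submodule.span_empty] at hsp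
    have h0 : w 0 ∈ Submodule.span ℂ (Set.range w) := Submodule.subset_span ⟨0, rfl⟩
    rw [← hsp] at h0
    exact hw0 0 ((Submodule.mem_bot ℂ).1 h0)
  obtain ⟨r, hr⟩ : ∃ r, Fintype.card κ = r + 1 := ⟨_, (Nat.succ_pred Fintype.card_ne_zero).symm⟩
  have hle : Fintype.card κ ≤ m + 1 := by simpa using Fintype.card_le_of_injective a ha
  obtain ⟨s, hs⟩ := Nat.exists_eq_add_of_le (hr ▸ hle)
  let e₁ : Fin (r + 1) ≃ κ := (Fintype.equivFinOfCardEq hr).symm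
  have hg : Function.Injective (a ∘ e₁) := ha.comp e₁.injective
  have hc : Fintype.card (Fin s) = Fintype.card ((Set.range (a ∘ e₁))ᶜ : Set (Fin (m + 1))) := by
    rw [Fintype.card_compl_set, Set.card_range_of_injective hg, Fintype.card_fin, Fintype.card_fin,
      Fintype.card_fin]
    omega
  let e : Fin (r + 1) ⊕ Fin s ≃ Fin (m + 1) :=
    (Equiv.sumCongr (Equiv.ofInjective _ hg) (Fintype.equivOfCardEq hc)).trans
      (Equiv.Set.sumCompl (Set.range (a ∘ e₁)))
  have he : ∀ k, e (Sum.inl k) = a (e₁ k) := fun k => by simp [e]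
  -- Normalise a nonzero coordinate of each basis direction.
  have hl : ∀ k, ∃ l : Fin (m + 1), w (a (e₁ k)) (j.succAbove l) ≠ 0 := by
    intro k
    by_contra! h
    refine hw0 (a (e₁ k)) (funext fun b => ?_)
    exact Fin.succAboveCases j (hwj _) h b
  choose l hl using hl
  let u : Fin (r + 1) → Fin (m + 2) → ℂ :=
    fun k => (w (a (e₁ k)) (j.succAbove (l k)))⁻¹ • w (a (e₁ k))
  have hu : LinearIndependent ℂ u :=
    (hli.comp e₁ e₁.injective).units_smul
      (fun k => (Units.mk0 _ (hl k))⁻¹)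
  have husp : Submodule.span ℂ (Set.range w) ≤ Submodule.span ℂ (Set.range u) := by
    rw [← hsp, Submodule.span_le]
    rintro _ ⟨i, rfl⟩
    have : (w ∘ a) i = w (a (e₁ (e₁.symm i))) (j.succAbove (l (e₁.symm i))) • u (e₁.symm i) := by
      simp only [u, smul_smul]
      rw [mul_inv_cancel₀ (hl _), one_smul, e₁.apply_symm_apply]
      rfl
    rw [this]
    exact Submodule.smul_mem _ _ (Submodule.subset_span ⟨_, rfl⟩)
  have hb : ∀ q : Fin s, ∃ b : Fin (r + 1) → ℂ, ∑ k, b k • u k = w (e (Sum.inr q)) := fun q =>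
    (Submodule.mem_span_range_iff_exists_fun ℂ).1 (husp (Submodule.subset_span ⟨_, rfl⟩))
  choose b hb using hb
  -- Normalise a nonzero coefficient of each further direction.
  have hμ : ∀ q, ∃ μ, b q μ ≠ 0 := by
    intro q
    by_contra! h
    refine hw0 (e (Sum.inr q)) ?_
    rw [← hb]
    exact Finset.sum_eq_zero fun k _ => by rw [h, zero_smul]
  choose μ hμ using hμ
  let χ : ConfigChart m r s := ⟨j, l, μ⟩
  let x : ConfigParam m r s → ℂ := Sum.elim (fun i => p (j.succAbove i))
    (Sum.elim (fun y => u y.1 (j.succAbove ((l y.1).succAbove y.2)))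
      fun y => (b y.1 (μ y.1))⁻¹ * b y.1 ((μ y.1).succAbove y.2))
  have hbasis : χ.basisDir x = u := by
    funext k
    refine (Fin.eq_insertNth_iff.2 ⟨?_, ?_⟩).symm
    · simp [u, χ, hwj]
    · refine Fin.eq_insertNth_iff.2 ⟨?_, ?_⟩
      · simp only [Fin.removeNth, u, χ, Pi.smul_apply, smul_eq_mul]
        exact inv_mul_cancel₀ (hl k)
      · rfl
  have hextra : ∀ q, χ.dir x (Sum.inr q) = (b q (μ q))⁻¹ • w (e (Sum.inr q)) := by
    intro q
    have hcoef : (μ q).insertNth (α := fun _ => ℂ) 1 (fun a => x (Sum.inr (Sum.inr (q, a)))) =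
        (b q (μ q))⁻¹ • b q := by
      refine (Fin.eq_insertNth_iff.2 ⟨?_, ?_⟩).symm
      · exact inv_mul_cancel₀ (hμ q)
      · rfl
    have : χ.dir x (Sum.inr q) = ∑ k, ((b q (μ q))⁻¹ • b q) k • χ.basisDir x k := by
      rw [← hcoef]
      rfl
    rw [this, hbasis, ← hb, Finset.smul_sum]
    exact Finset.sum_congr rfl fun k _ => by rw [Pi.smul_apply, smul_assoc]
  have hdir : ∀ i, ∃ c : ℂ, c ≠ 0 ∧ χ.dir x i = c • w (e i) := by
    rintro (k | q)
    · refine ⟨_, inv_ne_zero (hl k), ?_⟩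
      rw [he]
      exact congrFun hbasis k
    · exact ⟨_, inv_ne_zero (hμ q), hextra q⟩
  refine ⟨r, s, hs.symm, χ, x, ⟨hbasis ▸ hu, fun i i' hne hmem => ?_⟩, ?_, fun i => ?_⟩
  · obtain ⟨c, hc0, hc⟩ := hdir i
    obtain ⟨c', hc0', hc'⟩ := hdir i'
    rw [hc, hc', Submodule.span_singleton_smul_eq (IsUnit.mk0 c' hc0'),
      Submodule.smul_mem_iff _ hc0] at hmem
    exact hw _ _ (fun h => hne (e.injective h)) hmem
  · exact (Fin.eq_insertNth_iff.2 ⟨hp, rfl⟩).symm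
  · obtain ⟨c, -, hc⟩ := hdir i
    exact ⟨e i, c, hc⟩

theorem exists_formCoeffs_mem_badCoeffs {m d : ℕ} (f : FormSpace (m + 1) d) {j : Fin (m + 2)}
    {w : Fin (m + 1) → Fin (m + 2) → ℂ} (hwj : ∀ k, w k j = 0) (hw0 : ∀ k, w k ≠ 0)
    (hw : ∀ k k', k' ≠ k → w k ∉ Submodule.span ℂ {w k'})
    {p : Fin (m + 2) → ℂ} (hp : p j = 1)
    (hf : ∀ k (t : ℂ), MvPolynomial.eval (p + t • w k) f.1 = 0) :
    ∃ r s, r + 1 + s = m + 1 ∧ ∃ χ : ConfigChart m r s, formCoeffs f ∈ badCoeffs d χ := by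
  obtain ⟨r, s, hrs, χ, x, hx, hpoint, hdir⟩ := exists_config_of_directions hwj hw0 hw hp
  have hline : ∀ i, restrictLine p (χ.dir x i) f.1 = 0 := by
    intro i
    obtain ⟨k, c, hc⟩ := hdir i
    refine Polynomial.funext fun t => ?_
    rw [eval_restrictLine, hc, smul_smul, hf, Polynomial.eval_zero]
  refine ⟨r, s, hrs, χ, x, hx, ?_⟩
  funext c
  rw [lineConditions_mulVec_formCoeffs, hpoint]
  rcases c with _ | ⟨k, a⟩ | ⟨q, b⟩
  · simp only [conditionDegree, conditionDir]
    rw [Polynomial.coeff_zero_eq_eval_zero, eval_restrictLine]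
    simpa using hf 0 0
  · simp only [conditionDir, hline, Polynomial.coeff_zero, Pi.zero_apply]
  · simp only [conditionDir, hline, Polynomial.coeff_zero, Pi.zero_apply]

/-- A plane through a vector `p` with `p j = 1` is spanned by `p` and a vector `v` with
`v j = 0`. -/
theorem exists_span_pair_eq {n : ℕ} {W : Submodule ℂ (Fin (n + 1) → ℂ)}
    (hW : Module.finrank ℂ W = 2) {p : Fin (n + 1) → ℂ} (hpW : p ∈ W) {j : Fin (n + 1)}
    (hp : p j = 1) : ∃ v, v j = 0 ∧ v ≠ 0 ∧ Submodule.span ℂ {p, v} = W := by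
  obtain ⟨y, hyW, hy⟩ : ∃ y ∈ W, y ∉ Submodule.span ℂ {p} := by
    by_contra! h
    have h1 := Submodule.finrank_mono (show W ≤ Submodule.span ℂ {p} from h)
    have h2 := finrank_span_singleton (K := ℂ) (v := p) (by rintro rfl; simp at hp)
    omega
  have hv : y - y j • p ∉ Submodule.span ℂ {p} := fun h => hy <| by
    simpa using add_mem h (Submodule.smul_mem _ (y j) (Submodule.mem_span_singleton_self p))
  have hp0 : p ≠ 0 := by rintro rfl; simp at hp
  refine ⟨y - y j • p, by simp [hp], fun h => hv (h ▸ zero_mem _), ?_⟩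
  have hle : Submodule.span ℂ {p, y - y j • p} ≤ W := by
    rw [Submodule.span_le, Set.insert_subset_iff, Set.singleton_subset_iff]
    exact ⟨hpW, sub_mem hyW (Submodule.smul_mem _ _ hpW)⟩
  refine Submodule.eq_of_le_of_finrank_eq hle ?_
  have hli : LinearIndependent ℂ ![p, y - y j • p] := by
    rw [LinearIndependent.pair_iff' hp0]
    exact fun a ha => hv (ha ▸ Submodule.smul_mem _ a (Submodule.mem_span_singleton_self p))
  have := finrank_span_eq_card hli
  rw [Matrix.range_cons, Matrix.range_cons, Matrix.range_empty, Set.union_empty,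
    Set.singleton_union, Fintype.card_fin] at this
  rw [this, hW]

/-- A hypersurface of degree `d` containing `m + 1` distinct lines through a point is bad. -/
theorem exists_formCoeffs_rep_mem_badCoeffs {m d : ℕ} (F : HypersurfaceSpace (m + 1) d)
    (p : ProjSpace (m + 1))
    (h : ((m + 1 : ℕ) : ℕ∞) ≤ (linesThrough (zeroLocus F) p).encard) :
    ∃ r s, r + 1 + s = m + 1 ∧ ∃ χ : ConfigChart m r s, formCoeffs F.rep ∈ badCoeffs d χ := by
  classical
  obtain ⟨S, hS, hcard⟩ := Set.exists_subset_encard_eq h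
  have hfin : S.Finite := Set.finite_of_encard_eq_coe hcard
  have := hfin.fintype
  have hcard' : Fintype.card S = m + 1 := by
    rw [Set.encard_eq_coe_toFinset_card, Set.toFinset_card] at hcard
    exact_mod_cast hcard
  let e : Fin (m + 1) ≃ S := (Fintype.equivFinOfCardEq hcard').symm
  have hlines : ∀ k, ∃ W : Submodule ℂ (Fin (m + 2) → ℂ), Module.finrank ℂ W = 2 ∧
      ((e k).1 : Set (ProjSpace (m + 1))) = {q | q.submodule ≤ W} := fun k => (hS (e k).2).1
  choose W hW hWe using hlines
  obtain ⟨j, hj⟩ : ∃ j, p.rep j ≠ 0 := by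
    by_contra! h0
    exact p.rep_nonzero (funext h0)
  set p' : Fin (m + 2) → ℂ := (p.rep j)⁻¹ • p.rep with hp'
  have hp'j : p' j = 1 := by simp [hp', hj]
  have hpW : ∀ k, p' ∈ W k := by
    intro k
    have h1 : p ∈ (e k).1 := (hS (e k).2).2.1
    rw [hWe] at h1
    refine Submodule.smul_mem _ _ (h1 ?_)
    rw [Projectivization.submodule_eq]
    exact Submodule.mem_span_singleton_self _
  choose w hwj hw0 hspan using fun k => exists_span_pair_eq (hW k) (hpW k) hp'j
  refine exists_formCoeffs_mem_badCoeffs F.rep hwj hw0 (fun k k' hne hmem => ?_) hp'j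
    fun k t => ?_
  · -- Proportional directions span the same line.
    have hle : W k ≤ W k' := by
      rw [← hspan k, Submodule.span_le, Set.insert_subset_iff, Set.singleton_subset_iff]
      refine ⟨hpW k', ?_⟩
      rw [← hspan k']
      exact Submodule.span_mono (by simp) hmem
    have heq : W k = W k' := Submodule.eq_of_le_of_finrank_eq hle (by rw [hW, hW])
    refine hne (e.injective (Subtype.ext ?_))
    rw [hWe, hWe, heq]
  · have hy0 : p' + t • w k ≠ 0 := fun h0 => by
      have := congrFun h0 j
      simp [hp'j, hwj] at this
    have hmem : Projectivization.mk ℂ _ hy0 ∈ (e k).1 := by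
      rw [hWe]
      change Projectivization.submodule _ ≤ W k
      rw [Projectivization.submodule_mk, Submodule.span_singleton_le_iff_mem]
      refine add_mem (hpW k) (Submodule.smul_mem _ _ ?_)
      rw [← hspan k]
      exact Submodule.subset_span (by simp)
    have hz := (hS (e k).2).2.2 hmem
    rw [← F.mk_rep] at hz
    exact (mk_mem_zeroLocus_mk F.rep F.rep_nonzero _ hy0).1 hz

/-! ### The open set of hypersurfaces -/

/-- A nonzero polynomial in the coefficients is nonzero at some nonzero form. -/
theorem exists_form_eval_ne_zero {n d : ℕ} {P : MvPolynomial (MonomialIndex n d) ℂ} (hP : P ≠ 0) :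
    ∃ f : FormSpace n d, f ≠ 0 ∧ MvPolynomial.eval (formCoeffs f) P ≠ 0 := by
  classical
  let τ : MonomialIndex n d := ⟨Finsupp.single 0 d, by simp⟩
  -- The factor `X τ` forces the form to be nonzero, also when `P` is constant.
  have hPX : P * MvPolynomial.X τ ≠ 0 := mul_ne_zero hP (MvPolynomial.X_ne_zero τ)
  obtain ⟨y, hy⟩ : ∃ y, MvPolynomial.eval y (P * MvPolynomial.X τ) ≠ 0 := by
    by_contra! h
    exact hPX (MvPolynomial.funext fun y => by rw [h, map_zero])
  rw [map_mul, MvPolynomial.eval_X] at hy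
  let f : FormSpace n d := ∑ σ : MonomialIndex n d,
    ⟨MvPolynomial.monomial σ.1 (y σ), (MvPolynomial.mem_homogeneousSubmodule d _).2
      (MvPolynomial.isHomogeneous_monomial _ σ.2)⟩
  have hf : formCoeffs f = y := by
    funext σ
    simp only [formCoeffs, f, Submodule.coe_sum, MvPolynomial.coeff_sum,
      MvPolynomial.coeff_monomial]
    rw [Finset.sum_eq_single σ]
    · simp
    · intro σ' _ hne
      rw [if_neg fun h => hne (Subtype.ext h)]
    · simp
  refine ⟨f, fun h0 => right_ne_zero_of_mul hy ?_, by rw [hf]; exact left_ne_zero_of_mul hy⟩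
  rw [← hf, h0]
  simp [formCoeffs]

theorem mainTheorem8 (n d : ℕ) (hn : 1 ≤ n) (hd : n ≤ d) :
    ∃ U : Set (HypersurfaceSpace n d), IsZariskiOpen U ∧ U.Nonempty ∧
      ∀ X ∈ U, ∀ p ∈ zeroLocus X, (linesThrough (zeroLocus X) p).encard ≤ ((n - 1 : ℕ) : ℕ∞) := by
  obtain ⟨m, rfl⟩ : ∃ m, n = m + 1 := ⟨n - 1, by omega⟩
  have hsmall : InHypersurfaceCone
      (⋃ r : Fin (m + 1), ⋃ χ : ConfigChart m r (m - r), badCoeffs d χ) :=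
    InHypersurfaceCone.iUnion fun r => InHypersurfaceCone.iUnion fun χ =>
      inHypersurfaceCone_badCoeffs (by omega) hd χ
  obtain ⟨P, hP0, ⟨k, hk⟩, hP⟩ := hsmall
  refine ⟨{F | MvPolynomial.eval (formCoeffs F.rep) P ≠ 0}, ⟨{P}, ?_, ?_⟩, ?_, ?_⟩
  · rintro Q rfl
    exact ⟨k, hk⟩
  · ext F
    simp
  · obtain ⟨f, hf0, hf⟩ := exists_form_eval_ne_zero hP0
    exact ⟨Projectivization.mk ℂ f hf0, fun h => hf ((eval_formCoeffs_mk_rep hk f hf0).1 h)⟩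
  · intro F hF p _
    by_contra! hlt
    have hle : ((m + 1 : ℕ) : ℕ∞) ≤ (linesThrough (zeroLocus F) p).encard := by
      rw [Nat.add_sub_cancel] at hlt
      simpa using Order.add_one_le_of_lt hlt
    obtain ⟨r, s, hrs, χ, hχ⟩ := exists_formCoeffs_rep_mem_badCoeffs F p hle
    obtain rfl : s = m - r := by omega
    refine hF (hP _ (Set.mem_iUnion.2 ⟨⟨r, by omega⟩, Set.mem_iUnion.2 ⟨χ, hχ⟩⟩))
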